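/- Let $W$ be a Riemann surface and let $\pi\colon W\to\mathbb C$ be a holomorphic function (projection) whose derivative vanishes nowhere. Let $\rho$ be the metric on $W$ lifted from $\mathbb C$ by $\pi$, i.e. $\rho(p,q)$ is the infimum of the Euclidean lengths of $\pi\circ\gamma$ over all paths $\gamma$ in $W$ from $p$ to $q$. Let $U\subset W$ be a domain conformally equivalent to a disk, and let $K\subset U$ be a path-connected compact set that is not a single point and not empty. The intrinsic diameter $\operatorname{diam}_{int}K$ is the supremum over $p,q\in K$ of the infimum of the $\rho$-lengths of the paths contained in $K$ that connect $p$ and $q$ (it is $\infty$ if for some pair there is no path of finite length). For $p\in U$ let $\varepsilon(p,\partial U)$ be the supremum of the radii $r$ such that some open set $\Delta\subset U$ containing $p$ is mapped by $\pi$ bijectively onto the disk of radius $r$ centered at $\pi(p)$, and put $\pi\text{-gap}(K,\partial U)=\inf_{p\in K}\varepsilon(p,\partial U)$. Let $D\ge 0$ and $\varepsilon>0$ be such that $$\operatorname{diam}_{int}K\le D,\qquad \pi\text{-gap}(K,\partial U)\ge\varepsilon .$$ Let $I$ be a holomorphic function on $U$ that is bounded and not identically zero on $U$ (for instance, the restriction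 to $U$ of a bounded holomorphic function on $\overline U$, not identically zero). Then $I$ has finitely many zeros in $K$, and $$\#\{z\in K : I(z)=0\}\le e^{2D/\varepsilon}\,\log\frac{\sup_U|I|}{\max_K|I|}.$$ The same bound holds for the number of zeros of $I$ in $K$ counted with multiplicities. -/

import Mathlib

open scoped Manifold ENNReal NNReal unitInterval

noncomputable section

namespace GrowthZeros

/-- `U` is conformally equivalent to a disk: there is a biholomorphic map of `U` onto the open
unit disk of `ℂ`. (In particular, `U` is open, nonempty and connected.) -/
def ConformalToDisk {W : Type*} [TopologicalSpace W] [ChartedSpace ℂ W] (U : Set W) : Prop :=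
  ∃ φ : OpenPartialHomeomorph W ℂ, φ.source = U ∧ φ.target = Metric.ball (0 : ℂ) 1 ∧
    MDifferentiableOn 𝓘(ℂ) 𝓘(ℂ) φ U ∧
    MDifferentiableOn 𝓘(ℂ) 𝓘(ℂ) φ.symm (Metric.ball (0 : ℂ) 1)

/-- The (extended) metric on `W` lifted from `ℂ` by the projection `π`: the distance between two
points is the infimum, over all paths of `W` that connect them, of the Euclidean length of the
projected path. -/
def liftedDist {W : Type*} [TopologicalSpace W] (π : W → ℂ) (p q : W) : ℝ≥0∞ :=
  ⨅ γ : Path p q, eVariationOn (fun t : I => π (γ t)) Set.univ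

/-- The length of a parametrized curve with respect to a distance function `d`: the supremum of
the lengths of inscribed polygons. -/
def curveLength {X : Type*} (d : X → X → ℝ≥0∞) (γ : I → X) : ℝ≥0∞ :=
  ⨆ u : ℕ × {u : ℕ → I // Monotone u},
    ∑ i ∈ Finset.range u.1, d (γ (u.2.1 i)) (γ (u.2.1 (i + 1)))

/-- The intrinsic distance in `K` between `p` and `q`: the infimum of the lengths of the paths in
`K` that connect these points (`∞` if no such path has finite length). -/
def intrinsicDist {X : Type*} [TopologicalSpace X] (d : X → X → ℝ≥0∞) (K : Set X) (p q : X) :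
    ℝ≥0∞ :=
  ⨅ (γ : Path p q) (_ : ∀ t, γ t ∈ K), curveLength d γ

/-- The intrinsic diameter of `K`: the supremum of the intrinsic distances between two points. -/
def intrinsicDiam {X : Type*} [TopologicalSpace X] (d : X → X → ℝ≥0∞) (K : Set X) : ℝ≥0∞ :=
  ⨆ (p ∈ K) (q ∈ K), intrinsicDist d K p q

/-- `Δ` is a disk of radius `r` centered at `p` on which `π` is bijective: an open set containing
`p` that `π` maps bijectively onto the disk of radius `r` centered at `π p`. -/
def IsLiftedDisk {W : Type*} [TopologicalSpace W] (π : W → ℂ) (p : W) (r : ℝ≥0) (Δ : Set W) :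
    Prop :=
  IsOpen Δ ∧ p ∈ Δ ∧ Set.BijOn π Δ (Metric.ball (π p) r)

/-- The supremum `ε(p, ∂U)` of the radii of the disks centered at `p` that are located in `U` and
on which `π` is bijective. -/
def pointGap {W : Type*} [TopologicalSpace W] (π : W → ℂ) (U : Set W) (p : W) : ℝ≥0∞ :=
  ⨆ (r : ℝ≥0) (_ : ∃ Δ : Set W, IsLiftedDisk π p r Δ ∧ Δ ⊆ U), (r : ℝ≥0∞)

/-- The `π`-gap between `K` and `∂U`: the minimum of `ε(p, ∂U)` over `p ∈ K`. -/
def piGap {W : Type*} [TopologicalSpace W] (π : W → ℂ) (K U : Set W) : ℝ≥0∞ :=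
  ⨅ p ∈ K, pointGap π U p

/-- The Bernstein index `log (M / m)`, where `M = sup_U |f|` and `m = max_K |f|`. -/
def bernsteinIndex {W : Type*} (K U : Set W) (f : W → ℂ) : ℝ :=
  Real.log (sSup ((fun z => ‖f z‖) '' U) / sSup ((fun z => ‖f z‖) '' K))

/-- The set `{z ∈ K | f z = 0}` of zeros of `f` in `K`. -/
def zerosIn {W : Type*} (K : Set W) (f : W → ℂ) : Set W := {z ∈ K | f z = 0}

/-- The multiplicity of `z` as a zero of `f`: the order of vanishing at `z` of `f` read in the
preferred chart at `z`. -/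
def zeroMult {W : Type*} [TopologicalSpace W] [ChartedSpace ℂ W] (f : W → ℂ) (z : W) : ℕ∞ :=
  analyticOrderAt (f ∘ (chartAt ℂ z).symm) (chartAt ℂ z z)

end GrowthZeros

end

/-! Uniformize `U` by the unit disk, sending a point `z₀` of `K` where `|f|` is maximal on `K` to
`0`. Dividing out one disk automorphism per zero keeps the bound `M = sup_U |f|`, so `|f z₀| ≤ M ∏
|a|` over the images `a` of the zeros (`norm_apply_zero_le_mul_prod`). It remains to keep the `a`
away from the unit circle: if each lies within hyperbolic distance `ρ` of `0`, then `|a| ≤ exp (-exp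
(-ρ))`, and taking logarithms gives at most `exp ρ * log (M / |f z₀|)` zeros.

The value `ρ = 2 * D / ε` comes from the Schwarz lemma for inverse branches of `π`
(`norm_moebius_le_of_bijOn`): near each point of `K`, the hyperbolic distance from it is at most
about `2 / ε` times the Euclidean one downstairs. Adding this up along paths in `K`
(`edist_le_mul_eVariationOn`) bounds the hyperbolic distance from `z₀`
(`hypDist_le_of_intrinsicDiam_le`). -/

namespace GrowthZeros

open Metric Set Filter Topology ComplexConjugate

/-! ### Automorphisms of the unit disk -/

/-- The involutive automorphism of the unit disk that exchanges `a` and `0`. -/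
noncomputable def moebius (a z : ℂ) : ℂ := (a - z) / (1 - conj a * z)

theorem normSq_sub_add_mul (a z : ℂ) :
    ‖a - z‖ ^ 2 + (1 - ‖a‖ ^ 2) * (1 - ‖z‖ ^ 2) = ‖1 - conj a * z‖ ^ 2 := by
  simp only [← Complex.normSq_eq_norm_sq, Complex.normSq_apply, Complex.sub_re, Complex.sub_im,
    Complex.mul_re, Complex.mul_im, Complex.conj_re, Complex.conj_im, Complex.one_re,
    Complex.one_im]
  ring

theorem one_sub_conj_mul_ne_zero {a z : ℂ} (ha : ‖a‖ < 1) (hz : ‖z‖ < 1) :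
    1 - conj a * z ≠ 0 := by
  intro h
  have h1 : ‖conj a * z‖ < 1 := by
    rw [norm_mul, RCLike.norm_conj]
    nlinarith [norm_nonneg a, norm_nonneg z]
  rw [← sub_eq_zero.mp h] at h1
  simp at h1

theorem norm_moebius (a z : ℂ) : ‖moebius a z‖ = ‖a - z‖ / ‖1 - conj a * z‖ := norm_div _ _

theorem norm_moebius_lt_one {a z : ℂ} (ha : ‖a‖ < 1) (hz : ‖z‖ < 1) : ‖moebius a z‖ < 1 := by
  have h0 : 0 < ‖1 - conj a * z‖ := norm_pos_iff.mpr (one_sub_conj_mul_ne_zero ha hz)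
  rw [norm_moebius, div_lt_one h0]
  have h1 : 0 < (1 - ‖a‖ ^ 2) * (1 - ‖z‖ ^ 2) := by
    apply mul_pos <;> nlinarith [norm_nonneg a, norm_nonneg z]
  have := normSq_sub_add_mul a z
  exact lt_of_pow_lt_pow_left₀ 2 h0.le (by linarith)

theorem moebius_self (a : ℂ) : moebius a a = 0 := by simp [moebius]

theorem moebius_zero (a : ℂ) : moebius a 0 = a := by simp [moebius]

theorem moebius_moebius {a z : ℂ} (ha : ‖a‖ < 1) (hz : ‖z‖ < 1) :
    moebius a (moebius a z) = z := by
  have h0 := one_sub_conj_mul_ne_zero ha hz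
  have h1 := one_sub_conj_mul_ne_zero ha ha
  have h2 : 1 - conj a * moebius a z = (1 - conj a * a) / (1 - conj a * z) := by
    rw [moebius]; field_simp; ring
  have h3 : a - moebius a z = z * (1 - conj a * a) / (1 - conj a * z) := by
    rw [moebius, eq_div_iff h0, sub_mul, div_mul_cancel₀ _ h0]; ring
  rw [moebius, h2, h3, div_div_div_cancel_right₀ h0, mul_div_cancel_right₀ _ h1]

theorem mapsTo_moebius {a : ℂ} (ha : ‖a‖ < 1) : MapsTo (moebius a) (ball 0 1) (ball 0 1) :=
  fun z hz => by simpa using norm_moebius_lt_one ha (by simpa using hz)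

theorem hasDerivAt_moebius {a z : ℂ} (ha : ‖a‖ < 1) (hz : ‖z‖ < 1) :
    HasDerivAt (moebius a) (-(1 - conj a * a) / (1 - conj a * z) ^ 2) z := by
  have h1 : HasDerivAt (fun z => a - z) (-1) z := by simpa using (hasDerivAt_id z).const_sub a
  have h2 : HasDerivAt (fun z => 1 - conj a * z) (-(conj a)) z := by
    simpa using ((hasDerivAt_id z).const_mul (conj a)).const_sub 1
  refine (h1.div h2 (one_sub_conj_mul_ne_zero ha hz)).congr_deriv ?_
  congr 1
  ring

theorem differentiableOn_moebius {a : ℂ} (ha : ‖a‖ < 1) :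
    DifferentiableOn ℂ (moebius a) (ball 0 1) := fun _ hz =>
  (hasDerivAt_moebius ha (by simpa using hz)).differentiableAt.differentiableWithinAt

theorem analyticAt_moebius {a z : ℂ} (ha : ‖a‖ < 1) (hz : ‖z‖ < 1) :
    AnalyticAt ℂ (moebius a) z :=
  (differentiableOn_moebius ha).analyticAt (isOpen_ball.mem_nhds (by simpa using hz))

theorem analyticOrderAt_moebius_self {a : ℂ} (ha : ‖a‖ < 1) :
    analyticOrderAt (moebius a) a = 1 := by
  apply (analyticAt_moebius ha ha).analyticOrderAt_eq_one_of_zero_deriv_ne_zero (moebius_self a)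
  rw [(hasDerivAt_moebius ha ha).deriv]
  have h1 := one_sub_conj_mul_ne_zero ha ha
  exact div_ne_zero (neg_ne_zero.mpr h1) (pow_ne_zero 2 h1)

theorem analyticOrderAt_moebius_of_ne {a z : ℂ} (ha : ‖a‖ < 1) (hz : ‖z‖ < 1) (hne : z ≠ a) :
    analyticOrderAt (moebius a) z = 0 := by
  rw [analyticOrderAt_eq_zero]
  exact Or.inr (div_ne_zero (sub_ne_zero.mpr hne.symm) (one_sub_conj_mul_ne_zero ha hz))

/-! ### Dividing out zeros, and Jensen's inequality -/

/-- A bounded holomorphic function on the unit disk that vanishes at `a` is divisible by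
`moebius a`, and the quotient has the same bound. -/
theorem exists_eq_moebius_mul {F : ℂ → ℂ} {M : ℝ} {a : ℂ} (ha : ‖a‖ < 1)
    (hF : DifferentiableOn ℂ F (ball 0 1)) (hM : ∀ z ∈ ball (0 : ℂ) 1, ‖F z‖ ≤ M)
    (h0 : F a = 0) :
    ∃ G : ℂ → ℂ, DifferentiableOn ℂ G (ball 0 1) ∧ (∀ z ∈ ball (0 : ℂ) 1, ‖G z‖ ≤ M) ∧
      EqOn F (moebius a * G) (ball 0 1) := by
  -- The involution moves the zero to `0`, where the Schwarz lemma bounds `H w / w`, i.e. `dslope H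
  -- 0`, by `M`.
  set H : ℂ → ℂ := F ∘ moebius a with hH
  have hHd : DifferentiableOn ℂ H (ball 0 1) :=
    hF.comp (differentiableOn_moebius ha) (mapsTo_moebius ha)
  have hH0 : H 0 = 0 := by simp [hH, moebius_zero, h0]
  have hHM : MapsTo H (ball 0 1) (closedBall (H 0) M) := fun z hz => by
    rw [hH0]
    exact mem_closedBall_zero_iff.mpr (hM _ (mapsTo_moebius ha hz))
  refine ⟨dslope H 0 ∘ moebius a, ?_, fun z hz => ?_, fun z hz => ?_⟩
  · exact ((Complex.differentiableOn_dslope (ball_mem_nhds 0 one_pos)).mpr hHd).comp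
      (differentiableOn_moebius ha) (mapsTo_moebius ha)
  · simpa using Complex.norm_dslope_le_div_of_mapsTo_ball hHd hHM (mapsTo_moebius ha hz)
  · have h1 := sub_smul_dslope H 0 (moebius a z)
    rw [hH0, sub_zero, sub_zero, smul_eq_mul] at h1
    rw [Pi.mul_apply, Function.comp_apply, h1, hH, Function.comp_apply,
      moebius_moebius ha (by simpa using hz)]

/-- The factor `moebius a ^ n` has order exactly `n` at `a`, so as long as `F` has higher order the
quotient still vanishes there and can be divided again. -/
theorem exists_eq_moebius_pow_mul {F : ℂ → ℂ} {M : ℝ} {a : ℂ} (ha : ‖a‖ < 1)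
    (hF : DifferentiableOn ℂ F (ball 0 1)) (hM : ∀ z ∈ ball (0 : ℂ) 1, ‖F z‖ ≤ M)
    (n : ℕ) (hn : (n : ℕ∞) ≤ analyticOrderAt F a) :
    ∃ G : ℂ → ℂ, DifferentiableOn ℂ G (ball 0 1) ∧ (∀ z ∈ ball (0 : ℂ) 1, ‖G z‖ ≤ M) ∧
      EqOn F (moebius a ^ n * G) (ball 0 1) := by
  induction n with
  | zero => exact ⟨F, hF, hM, fun z _ => by simp⟩
  | succ n ih =>
    obtain ⟨G, hG, hGM, hFG⟩ := ih (le_trans (by simp) hn)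
    have ha' : a ∈ ball (0 : ℂ) 1 := by simpa using ha
    have hnhds := isOpen_ball.mem_nhds ha'
    have hGa : G a = 0 := by
      apply apply_eq_zero_of_analyticOrderAt_ne_zero
      intro h
      rw [analyticOrderAt_congr (hFG.eventuallyEq_of_mem hnhds),
        analyticOrderAt_mul ((analyticAt_moebius ha ha).pow n) (hG.analyticAt hnhds),
        analyticOrderAt_pow (analyticAt_moebius ha ha), analyticOrderAt_moebius_self ha, h] at hn
      simp only [nsmul_eq_mul, mul_one, add_zero] at hn
      exact absurd (Nat.cast_le.mp hn) (by simp)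
    obtain ⟨H, hH, hHM, hGH⟩ := exists_eq_moebius_mul ha hG hGM hGa
    refine ⟨H, hH, hHM, fun z hz => ?_⟩
    rw [hFG hz, Pi.mul_apply, hGH hz, Pi.mul_apply, Pi.mul_apply, pow_succ, Pi.mul_apply, mul_assoc]

/-- Factors attached to other points have order `0` at `a`, so dividing by them leaves the order at
`a` unchanged. -/
theorem exists_eq_prod_moebius_pow_mul {F : ℂ → ℂ} {M : ℝ}
    (hF : DifferentiableOn ℂ F (ball 0 1)) (hM : ∀ z ∈ ball (0 : ℂ) 1, ‖F z‖ ≤ M)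
    (S : Finset ℂ) (n : ℂ → ℕ) (hS : ∀ a ∈ S, ‖a‖ < 1)
    (hn : ∀ a ∈ S, (n a : ℕ∞) ≤ analyticOrderAt F a) :
    ∃ G : ℂ → ℂ, DifferentiableOn ℂ G (ball 0 1) ∧ (∀ z ∈ ball (0 : ℂ) 1, ‖G z‖ ≤ M) ∧
      ∀ z ∈ ball (0 : ℂ) 1, F z = (∏ a ∈ S, moebius a z ^ n a) * G z := by
  induction S using Finset.induction_on generalizing F with
  | empty => exact ⟨F, hF, hM, fun z _ => by simp⟩
  | insert b S hb ih =>
    have hb1 := hS b (Finset.mem_insert_self _ _)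
    obtain ⟨G, hG, hGM, hFG⟩ :=
      exists_eq_moebius_pow_mul hb1 hF hM (n b) (hn b (Finset.mem_insert_self _ _))
    obtain ⟨H, hH, hHM, hGH⟩ := ih hG hGM (fun a ha => hS a (Finset.mem_insert_of_mem ha)) <| by
      intro a ha
      have ha1 := hS a (Finset.mem_insert_of_mem ha)
      have hnhds : ball (0 : ℂ) 1 ∈ 𝓝 a := isOpen_ball.mem_nhds (by simpa using ha1)
      have h := hn a (Finset.mem_insert_of_mem ha)
      rwa [analyticOrderAt_congr (hFG.eventuallyEq_of_mem hnhds),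
        analyticOrderAt_mul ((analyticAt_moebius hb1 ha1).pow _) (hG.analyticAt hnhds),
        analyticOrderAt_pow (analyticAt_moebius hb1 ha1),
        analyticOrderAt_moebius_of_ne hb1 ha1 (fun h => hb (h ▸ ha)), smul_zero, zero_add] at h
    refine ⟨H, hH, hHM, fun z hz => ?_⟩
    rw [hFG hz, Pi.mul_apply, hGH z hz, Finset.prod_insert hb, Pi.pow_apply, mul_assoc]

/-- **Jensen's inequality** for the zeros of a bounded holomorphic function on the unit disk. -/
theorem norm_apply_zero_le_mul_prod {F : ℂ → ℂ} {M : ℝ}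
    (hF : DifferentiableOn ℂ F (ball 0 1)) (hM : ∀ z ∈ ball (0 : ℂ) 1, ‖F z‖ ≤ M)
    (S : Finset ℂ) (n : ℂ → ℕ) (hS : ∀ a ∈ S, ‖a‖ < 1)
    (hn : ∀ a ∈ S, (n a : ℕ∞) ≤ analyticOrderAt F a) :
    ‖F 0‖ ≤ (∏ a ∈ S, ‖a‖ ^ n a) * M := by
  obtain ⟨G, -, hGM, hFG⟩ := exists_eq_prod_moebius_pow_mul hF hM S n hS hn
  have h0 : (0 : ℂ) ∈ ball (0 : ℂ) 1 := mem_ball_self one_pos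
  rw [hFG 0 h0, norm_mul, norm_prod]
  simp only [moebius_zero, norm_pow]
  exact mul_le_mul_of_nonneg_left (hGM 0 h0) (by positivity)

/-! ### Hyperbolic distance to the center -/

/-- The distance from `0` to `w` in the hyperbolic metric of the unit disk (of curvature `-1`). -/
noncomputable def hypDist (w : ℂ) : ℝ := Real.log ((1 + ‖w‖) / (1 - ‖w‖))

theorem hypDist_zero : hypDist 0 = 0 := by simp [hypDist]

theorem hypDist_le_add {w w' : ℂ} (hw : ‖w‖ < 1) (hw' : ‖w'‖ < 1) {x : ℝ} (hx0 : 0 ≤ x)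
    (hx : x < 1) (h : ‖moebius w w'‖ ≤ x) :
    hypDist w ≤ hypDist w' + Real.log ((1 + x) / (1 - x)) := by
  have hne := one_sub_conj_mul_ne_zero hw hw'
  rw [norm_moebius, div_le_iff₀ (norm_pos_iff.mpr hne)] at h
  have hid := normSq_sub_add_mul w w'
  have hB : ‖1 - conj w * w'‖ ≥ 1 - ‖w‖ * ‖w'‖ := by
    have := norm_sub_norm_le 1 (conj w * w')
    rwa [norm_mul, RCLike.norm_conj, norm_one] at this
  set u := ‖w‖
  set v := ‖w'‖
  set A := ‖w - w'‖
  set B := ‖1 - conj w * w'‖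
  have hu : 0 ≤ u := norm_nonneg _
  have hv : 0 ≤ v := norm_nonneg _
  have hA : 0 ≤ A := norm_nonneg _
  have huv : 0 < 1 - u * v := by nlinarith
  have hB0 : 0 < B := huv.trans_le hB
  -- Among points of moduli `u` and `v`, those on a common radius are closest. For them the identity
  -- reads `(u - v) ^ 2 + (1 - u ^ 2) * (1 - v ^ 2) = (1 - u * v) ^ 2`.
  have key : u - v ≤ x * (1 - u * v) := by
    have h1 : A ^ 2 ≤ x ^ 2 * B ^ 2 := by rw [← mul_pow]; exact pow_le_pow_left₀ hA h 2
    have h2 : (1 - x ^ 2) * B ^ 2 ≤ (1 - u ^ 2) * (1 - v ^ 2) := by nlinarith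
    have h3 : (1 - x ^ 2) * (1 - u * v) ^ 2 ≤ (1 - x ^ 2) * B ^ 2 := by
      apply mul_le_mul_of_nonneg_left (pow_le_pow_left₀ huv.le hB 2)
      nlinarith
    apply le_of_sq_le_sq ?_ (by positivity)
    nlinarith
  have hu1 : 0 < 1 - u := by linarith
  have hv1 : 0 < 1 - v := by linarith
  have hx1 : 0 < 1 - x := by linarith
  rw [hypDist, hypDist, ← Real.log_mul (by positivity) (by positivity)]
  apply Real.log_le_log (by positivity)
  rw [div_mul_div_comm, div_le_div_iff₀ hu1 (by positivity)]
  nlinarith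

theorem norm_moebius_comm (w w' : ℂ) : ‖moebius w w'‖ = ‖moebius w' w‖ := by
  rw [norm_moebius, norm_moebius, norm_sub_rev, ← RCLike.norm_conj (1 - conj w * w')]
  simp [mul_comm]

theorem abs_hypDist_sub_le {w w' : ℂ} (hw : ‖w‖ < 1) (hw' : ‖w'‖ < 1) {x : ℝ} (hx0 : 0 ≤ x)
    (hx : x < 1) (h : ‖moebius w w'‖ ≤ x) :
    |hypDist w - hypDist w'| ≤ Real.log ((1 + x) / (1 - x)) := by
  rw [abs_sub_le_iff]
  have h1 := hypDist_le_add hw hw' hx0 hx h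
  have h2 := hypDist_le_add hw' hw hx0 hx (by rwa [norm_moebius_comm])
  constructor <;> linarith

/-- Since `1 + ‖w‖ ≥ 1`, the hypothesis gives `‖w‖ ≤ 1 - exp (-ρ)`; then `1 - t ≤ exp (-t)`. -/
theorem norm_le_exp_of_hypDist_le {w : ℂ} (hw : ‖w‖ < 1) {ρ : ℝ} (h : hypDist w ≤ ρ) :
    ‖w‖ ≤ Real.exp (-Real.exp (-ρ)) := by
  have h0 := norm_nonneg w
  have hw1 : 0 < 1 - ‖w‖ := by linarith
  have h1 : (1 + ‖w‖) / (1 - ‖w‖) ≤ Real.exp ρ := (Real.log_le_iff_le_exp (by positivity)).mp h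
  rw [div_le_iff₀ hw1] at h1
  have h2 : Real.exp (-ρ) ≤ 1 - ‖w‖ := by
    have h3 : Real.exp (-ρ) * Real.exp ρ = 1 := by rw [← Real.exp_add]; simp
    have := mul_le_mul_of_nonneg_left h1 (Real.exp_pos (-ρ)).le
    rw [← mul_assoc, h3, one_mul] at this
    nlinarith [Real.exp_pos (-ρ)]
  linarith [Real.add_one_le_exp (-Real.exp (-ρ))]

/-- Near the center of a disk, hyperbolic distances to the center are at most `k` times the
normalized Euclidean distances, for every `k > 2`. -/
theorem eventually_log_div_le {k : ℝ} (hk : 2 < k) :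
    ∀ᶠ x in 𝓝 (0 : ℝ), 0 ≤ x → x < 1 ∧ Real.log ((1 + x) / (1 - x)) ≤ k * x := by
  -- For `0 ≤ x` below this threshold, `1 / (1 - x) - 1 ≤ (k - 1) * x`; the remaining `x` is spent
  -- on `log (1 + x)`.
  have hk' : 0 < (k - 2) / (k - 1) := div_pos (by linarith) (by linarith)
  filter_upwards [eventually_lt_nhds (show (0 : ℝ) < 1 by norm_num), eventually_lt_nhds hk']
    with x hx1 hx2 hx0
  refine ⟨hx1, ?_⟩
  have h1 : 0 < 1 - x := by linarith
  rw [lt_div_iff₀ (by linarith)] at hx2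
  rw [Real.log_div (by positivity) h1.ne']
  have h2 : Real.log (1 + x) ≤ x := by
    linarith [Real.log_le_sub_one_of_pos (show 0 < 1 + x by positivity)]
  have h3 : -Real.log (1 - x) ≤ (k - 1) * x := by
    rw [← Real.log_inv]
    refine (Real.log_le_sub_one_of_pos (inv_pos.mpr h1)).trans ?_
    rw [sub_le_iff_le_add, inv_le_iff_one_le_mul₀ h1]
    nlinarith
  linarith

/-! ### Local comparison by the Schwarz lemma, and summation along paths -/

/-- The **Schwarz lemma** for the inverse branch of `P` over a disk on which it is bijective. -/
theorem norm_moebius_le_of_bijOn {P : ℂ → ℂ} {Δ : Set ℂ} (hΔ : IsOpen Δ) (hΔ1 : Δ ⊆ ball 0 1)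
    (hP : DifferentiableOn ℂ P Δ) (hP' : ∀ w ∈ Δ, deriv P w ≠ 0) {w₀ : ℂ} (hw₀ : w₀ ∈ Δ) {r : ℝ}
    (hbij : BijOn P Δ (ball (P w₀) r)) {w : ℂ} (hw : w ∈ Δ) :
    ‖moebius w₀ w‖ ≤ ‖P w - P w₀‖ / r := by
  set s := Function.invFunOn P Δ
  have hinv : InvOn s P Δ (ball (P w₀) r) := hbij.invOn_invFunOn
  have hs : MapsTo s (ball (P w₀) r) Δ := hbij.surjOn.mapsTo_invFunOn
  have hstrict : ∀ z ∈ Δ, HasStrictDerivAt P (deriv P z) z := fun z hz =>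
    (hP.analyticAt (hΔ.mem_nhds hz)).hasStrictDerivAt
  -- A nonzero strict derivative makes `P` carry neighborhoods of `z` onto neighborhoods of `P z`,
  -- which gives continuity of the inverse.
  have hcont : ∀ z ∈ Δ, ContinuousAt s (P z) := by
    intro z hz
    rw [ContinuousAt, hinv.1 hz, ← (hstrict z hz).map_nhds_eq (hP' z hz), tendsto_map'_iff]
    exact tendsto_id.congr' (by
      filter_upwards [hΔ.mem_nhds hz] with y hy using (hinv.1 hy).symm)
  have hsd : DifferentiableOn ℂ s (ball (P w₀) r) := by
    intro y hy
    have hz := hs hy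
    have hc := hcont _ hz
    rw [hinv.2 hy] at hc
    exact (HasDerivAt.of_local_left_inverse hc (hstrict _ hz).hasDerivAt (hP' _ hz) (by
      filter_upwards [isOpen_ball.mem_nhds hy] with x hx using hinv.2 hx)).differentiableAt
      |>.differentiableWithinAt
  have hw₀1 : ‖w₀‖ < 1 := by simpa using hΔ1 hw₀
  have hs0 : moebius w₀ (s (P w₀)) = 0 := by rw [hinv.1 hw₀, moebius_self]
  have hmaps : MapsTo (moebius w₀ ∘ s) (ball (P w₀) r)
      (closedBall ((moebius w₀ ∘ s) (P w₀)) 1) := fun y hy => by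
    rw [Function.comp_apply, hs0]
    exact ball_subset_closedBall (mapsTo_moebius hw₀1 (hΔ1 (hs hy)))
  have := Complex.dist_le_div_mul_dist_of_mapsTo_ball
    ((differentiableOn_moebius hw₀1).comp hsd (hs.mono_right hΔ1)) hmaps (hbij.mapsTo hw)
  rw [Function.comp_apply, Function.comp_apply, hs0, hinv.1 hw, dist_zero_right, dist_eq_norm] at this
  rwa [div_mul_eq_mul_div, one_mul] at this

/-- A function whose increments are locally controlled by those of `P` has its total increment
controlled by the variation of `P`. -/
theorem edist_le_mul_eVariationOn {E : Type*} [PseudoEMetricSpace E] {q : I → ℝ} {P : I → E}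
    {c : ℝ≥0∞} (h : ∀ t, ∀ᶠ s in 𝓝 t, edist (q s) (q t) ≤ c * edist (P s) (P t)) :
    edist (q 1) (q 0) ≤ c * eVariationOn P univ := by
  -- Continuous induction: the supremum of `S` lies in `S` by the hypothesis on its left, and equals
  -- `1` by the hypothesis on its right.
  set S : Set I := {t | edist (q t) (q 0) ≤ c * eVariationOn P (Icc 0 t)}
  have step : ∀ s t : I, s ≤ t → s ∈ S → edist (q t) (q s) ≤ c * edist (P t) (P s) → t ∈ S := by
    intro s t hst hs hts
    have h1 := eVariationOn.Icc_add_Icc P (s := univ) (unitInterval.nonneg' : 0 ≤ s) hst trivial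
    simp only [univ_inter] at h1
    calc edist (q t) (q 0) ≤ edist (q t) (q s) + edist (q s) (q 0) := edist_triangle _ _ _
      _ ≤ c * eVariationOn P (Icc s t) + c * eVariationOn P (Icc 0 s) := by
        gcongr
        · exact hts.trans (by
            gcongr; exact eVariationOn.edist_le P (right_mem_Icc.mpr hst) (left_mem_Icc.mpr hst))
        · exact hs
      _ = c * eVariationOn P (Icc 0 t) := by rw [← mul_add, add_comm, h1]
  have h0 : (0 : I) ∈ S := by simp [S]
  have hsup : sSup S ∈ S := by
    obtain heq | hpos := eq_or_lt_of_le (unitInterval.nonneg' : 0 ≤ sSup S)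
    · rwa [← heq]
    · obtain ⟨l, hl, hls⟩ := exists_Ioc_subset_of_mem_nhds (h (sSup S)) ⟨0, hpos⟩
      obtain ⟨s, hs, hls'⟩ := lt_sSup_iff.mp hl
      refine step s _ (le_sSup hs) hs ?_
      have := hls ⟨hls', le_sSup hs⟩
      rw [edist_comm, edist_comm (P _)]
      exact this
  have hone : sSup S = 1 := by
    by_contra hne
    have hlt : sSup S < 1 := lt_of_le_of_ne unitInterval.le_one' hne
    obtain ⟨u, hu, hus⟩ := exists_Ico_subset_of_mem_nhds (h (sSup S)) ⟨1, hlt⟩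
    obtain ⟨s, hs, hs'⟩ := exists_between hu
    exact (le_sSup (step _ s hs.le hsup (hus ⟨hs.le, hs'⟩))).not_gt hs
  rw [hone] at hsup
  exact hsup.trans (by gcongr; exact eVariationOn.mono P (subset_univ _))

section

variable {W : Type*} [TopologicalSpace W]

theorem edist_le_liftedDist (π : W → ℂ) (p q : W) : edist (π p) (π q) ≤ liftedDist π p q := by
  refine le_iInf fun γ => ?_
  simpa using eVariationOn.edist_le (fun t : I => π (γ t)) (mem_univ 0) (mem_univ 1)

theorem eVariationOn_le_curveLength (π : W → ℂ) (γ : I → W) :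
    eVariationOn (fun t => π (γ t)) univ ≤ curveLength (liftedDist π) γ := by
  refine iSup_le fun u => le_iSup_of_le ⟨u.1, u.2.1, u.2.2.1⟩ ?_
  refine Finset.sum_le_sum fun i _ => ?_
  rw [edist_comm]
  exact edist_le_liftedDist π _ _

theorem edist_le_mul_intrinsicDist {π : W → ℂ} {K : Set W} {h : W → ℝ} {c : ℝ≥0} (hc : c ≠ 0)
    (hh : ∀ p ∈ K, ∀ᶠ q in 𝓝 p, edist (h q) (h p) ≤ c * edist (π q) (π p)) (p q : W) :
    edist (h q) (h p) ≤ c * intrinsicDist (liftedDist π) K p q := by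
  -- `c ≠ 0` matters: an infimum over no paths is `∞`, and `0 * ∞ = 0` would break the exchange.
  rw [intrinsicDist, ENNReal.mul_iInf_of_ne (by simpa) (by simp)]
  refine le_iInf fun γ => ?_
  rw [ENNReal.mul_iInf_of_ne (by simpa) (by simp)]
  refine le_iInf fun hγ => ?_
  have := edist_le_mul_eVariationOn (q := fun t => h (γ t)) (P := fun t => π (γ t)) (c := c)
    fun t => (γ.continuous.tendsto t).eventually (hh _ (hγ t))
  rw [γ.source, γ.target] at this
  exact this.trans (by gcongr; exact eVariationOn_le_curveLength π γ)

theorem dist_le_mul_of_intrinsicDiam_le {π : W → ℂ} {K : Set W} {h : W → ℝ} {c D : ℝ}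
    (hc : 0 < c) (hD : 0 ≤ D) (hdiam : intrinsicDiam (liftedDist π) K ≤ ENNReal.ofReal D)
    (hh : ∀ p ∈ K, ∀ᶠ q in 𝓝 p, |h q - h p| ≤ c * ‖π q - π p‖) {p q : W} (hp : p ∈ K)
    (hq : q ∈ K) : |h q - h p| ≤ c * D := by
  have h1 := edist_le_mul_intrinsicDist (π := π) (K := K) (h := h) (c := c.toNNReal)
    (by simpa using hc) (by
    intro p hp
    filter_upwards [hh p hp] with q hq
    rw [edist_dist, edist_dist, Real.dist_eq, dist_eq_norm]
    change _ ≤ ENNReal.ofReal c * _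
    rw [← ENNReal.ofReal_mul hc.le]
    exact ENNReal.ofReal_le_ofReal hq) p q
  have h2 : intrinsicDist (liftedDist π) K p q ≤ ENNReal.ofReal D :=
    (le_iSup₂ (f := fun q (_ : q ∈ K) => intrinsicDist (liftedDist π) K p q) q hq).trans
      ((le_iSup₂ (f := fun p (_ : p ∈ K) => ⨆ q ∈ K, intrinsicDist (liftedDist π) K p q) p hp).trans
        hdiam)
  have h3 : edist (h q) (h p) ≤ ENNReal.ofReal c * ENNReal.ofReal D :=
    h1.trans (mul_le_mul_right h2 _)
  rw [← ENNReal.ofReal_mul hc.le, edist_dist, Real.dist_eq] at h3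
  exact (ENNReal.ofReal_le_ofReal_iff (by positivity)).mp h3

end

/-! ### Transfer from the surface to the disk -/

/-- `moebius a` as an automorphism of the unit disk. -/
noncomputable def moebiusHomeomorph {a : ℂ} (ha : ‖a‖ < 1) : OpenPartialHomeomorph ℂ ℂ where
  toFun := moebius a
  invFun := moebius a
  source := ball 0 1
  target := ball 0 1
  map_source' _ hz := mapsTo_moebius ha hz
  map_target' _ hz := mapsTo_moebius ha hz
  left_inv' _ hz := moebius_moebius ha (by simpa using hz)
  right_inv' _ hz := moebius_moebius ha (by simpa using hz)
  open_source := isOpen_ball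
  open_target := isOpen_ball
  continuousOn_toFun := (differentiableOn_moebius ha).continuousOn
  continuousOn_invFun := (differentiableOn_moebius ha).continuousOn

theorem mdifferentiable_moebiusHomeomorph {a : ℂ} (ha : ‖a‖ < 1) :
    (moebiusHomeomorph ha).MDifferentiable 𝓘(ℂ) 𝓘(ℂ) :=
  ⟨(differentiableOn_moebius ha).mdifferentiableOn, (differentiableOn_moebius ha).mdifferentiableOn⟩

variable {W : Type*} [TopologicalSpace W] [ChartedSpace ℂ W]

theorem ConformalToDisk.exists_apply_eq_zero [IsManifold 𝓘(ℂ) 1 W] {U : Set W}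
    (hU : ConformalToDisk U) {z₀ : W} (hz₀ : z₀ ∈ U) :
    ∃ e : OpenPartialHomeomorph W ℂ, e.MDifferentiable 𝓘(ℂ) 𝓘(ℂ) ∧ e.source = U ∧
      e.target = ball 0 1 ∧ e z₀ = 0 := by
  obtain ⟨φ, hs, ht, hd, hd'⟩ := hU
  have hφ : φ.MDifferentiable 𝓘(ℂ) 𝓘(ℂ) := ⟨hs ▸ hd, ht ▸ hd'⟩
  have ha : ‖φ z₀‖ < 1 := by
    have := φ.map_source (hs ▸ hz₀)
    rw [ht] at this
    simpa using this
  have hm : φ.target = (moebiusHomeomorph ha).source := ht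
  refine ⟨φ.trans (moebiusHomeomorph ha), hφ.trans (mdifferentiable_moebiusHomeomorph ha), ?_, ?_,
    moebius_self _⟩
  · rw [OpenPartialHomeomorph.trans_source, ← hm, ← hs]
    exact inter_eq_left.mpr fun z hz => φ.map_source hz
  · rw [OpenPartialHomeomorph.trans_target, hm]
    exact inter_eq_left.mpr fun z hz => (moebiusHomeomorph ha).map_target hz

section disk

variable {e : OpenPartialHomeomorph W ℂ} (he : e.MDifferentiable 𝓘(ℂ) 𝓘(ℂ))
  (ht : e.target = ball 0 1)

include he in
theorem differentiableOn_comp_symm {f : W → ℂ} (hf : MDifferentiableOn 𝓘(ℂ) 𝓘(ℂ) f e.source) :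
    DifferentiableOn ℂ (f ∘ e.symm) e.target :=
  (hf.comp he.2 e.mapsTo_symm).differentiableOn

include he in
theorem deriv_comp_symm_ne_zero {π : W → ℂ} (hπ : MDifferentiable 𝓘(ℂ) 𝓘(ℂ) π)
    (hπ' : ∀ p, mfderiv 𝓘(ℂ) 𝓘(ℂ) π p ≠ 0) {w : ℂ} (hw : w ∈ e.target) :
    deriv (π ∘ e.symm) w ≠ 0 := by
  intro h0
  have h1 : mfderiv 𝓘(ℂ) 𝓘(ℂ) (π ∘ e.symm) w =
      (mfderiv 𝓘(ℂ) 𝓘(ℂ) π (e.symm w)).comp (mfderiv 𝓘(ℂ) 𝓘(ℂ) e.symm w) :=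
    mfderiv_comp w (hπ _) (he.mdifferentiableAt_symm hw)
  have h2 : mfderiv 𝓘(ℂ) 𝓘(ℂ) (π ∘ e.symm) w = 0 := by
    rw [mfderiv_eq_fderiv]
    refine ContinuousLinearMap.ext_ring ?_
    rw [fderiv_apply_one_eq_deriv, h0]
    rfl
  apply hπ' (e.symm w)
  refine ContinuousLinearMap.ext fun v => ?_
  obtain ⟨u, rfl⟩ := he.symm.mfderiv_surjective hw v
  rw [h2] at h1
  exact (congrArg (fun L => L u) h1).symm

include he ht in
theorem norm_moebius_le_of_isLiftedDisk {π : W → ℂ} (hπ : MDifferentiable 𝓘(ℂ) 𝓘(ℂ) π)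
    (hπ' : ∀ p, mfderiv 𝓘(ℂ) 𝓘(ℂ) π p ≠ 0) {p q : W} {r : ℝ≥0} {Δ : Set W}
    (hΔ : IsLiftedDisk π p r Δ) (hΔU : Δ ⊆ e.source) (hq : q ∈ Δ) :
    ‖moebius (e p) (e q)‖ ≤ ‖π q - π p‖ / r := by
  obtain ⟨hΔo, hpΔ, hbij⟩ := hΔ
  have himg : IsOpen (e '' Δ) := e.isOpen_image_of_subset_source hΔo hΔU
  have hsub : e '' Δ ⊆ e.target := by
    rintro _ ⟨z, hz, rfl⟩
    exact e.map_source (hΔU hz)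
  have hval : ∀ z ∈ Δ, (π ∘ e.symm) (e z) = π z := fun z hz => by
    rw [Function.comp_apply, e.left_inv (hΔU hz)]
  have hbij' : BijOn (π ∘ e.symm) (e '' Δ) (ball ((π ∘ e.symm) (e p)) r) := by
    rw [hval p hpΔ]
    refine hbij.comp ⟨?_, ?_, ?_⟩
    · rintro _ ⟨z, hz, rfl⟩
      rwa [e.left_inv (hΔU hz)]
    · exact e.symm.injOn.mono hsub
    · exact fun z hz => ⟨e z, mem_image_of_mem e hz, e.left_inv (hΔU hz)⟩
  have := norm_moebius_le_of_bijOn himg (ht ▸ hsub)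
    ((differentiableOn_comp_symm he hπ.mdifferentiableOn).mono hsub)
    (fun w hw => deriv_comp_symm_ne_zero he hπ hπ' (hsub hw)) (mem_image_of_mem e hpΔ) hbij'
    (mem_image_of_mem e hq)
  rwa [hval p hpΔ, hval q hq] at this

include he ht in
-- The gap is a supremum that need not be attained, hence the strict `2 / ε < c`: it leaves room for
-- a lifted disk of radius `r > 2 / c`, and then `k = c * r > 2` allows the linear bound on the
-- logarithm.
theorem eventually_abs_hypDist_sub_le {π : W → ℂ} (hπ : MDifferentiable 𝓘(ℂ) 𝓘(ℂ) π)
    (hπ' : ∀ p, mfderiv 𝓘(ℂ) 𝓘(ℂ) π p ≠ 0) {p : W} {ε c : ℝ} (hε : 0 < ε)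
    (hgap : ENNReal.ofReal ε ≤ pointGap π e.source p) (hc : 2 / ε < c) :
    ∀ᶠ q in 𝓝 p, |hypDist (e q) - hypDist (e p)| ≤ c * ‖π q - π p‖ := by
  have hc0 : 0 < c := lt_trans (by positivity) hc
  have h1 : ENNReal.ofReal (2 / c) < pointGap π e.source p := by
    refine lt_of_lt_of_le ((ENNReal.ofReal_lt_ofReal_iff hε).mpr ?_) hgap
    rwa [div_lt_comm₀ hc0 hε]
  obtain ⟨r, hr⟩ := lt_iSup_iff.mp h1
  obtain ⟨⟨Δ, hΔ, hΔU⟩, hr⟩ := lt_iSup_iff.mp hr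
  have hr' : 2 / c < r := by
    rwa [← ENNReal.ofReal_coe_nnreal, ENNReal.ofReal_lt_ofReal_iff_of_nonneg (by positivity)] at hr
  have hr0 : 0 < (r : ℝ) := lt_trans (by positivity) hr'
  have hk : 2 < c * r := by rwa [div_lt_iff₀' hc0] at hr'
  have hx : Tendsto (fun q => ‖π q - π p‖ / r) (𝓝 p) (𝓝 0) := by
    have h2 : Tendsto (fun q => ‖π q - π p‖ / r) (𝓝 p) (𝓝 (‖π p - π p‖ / r)) :=
      ((hπ.continuous.tendsto p).sub_const (π p)).norm.div_const _
    simpa using h2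
  have hlt : ∀ z ∈ Δ, ‖e z‖ < 1 := fun z hz => by
    simpa [ht] using e.map_source (hΔU hz)
  filter_upwards [hx.eventually (eventually_log_div_le hk), hΔ.1.mem_nhds hΔ.2.1] with q hq hqΔ
  obtain ⟨hq1, hq2⟩ := hq (by positivity)
  rw [abs_sub_comm]
  refine (abs_hypDist_sub_le (hlt p hΔ.2.1) (hlt q hqΔ) (by positivity) hq1
    (norm_moebius_le_of_isLiftedDisk he ht hπ hπ' hΔ hΔU hqΔ)).trans (hq2.trans_eq ?_)
  field_simp

include he ht in
theorem hypDist_le_of_intrinsicDiam_le {π : W → ℂ} (hπ : MDifferentiable 𝓘(ℂ) 𝓘(ℂ) π)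
    (hπ' : ∀ p, mfderiv 𝓘(ℂ) 𝓘(ℂ) π p ≠ 0) {K : Set W} {D ε : ℝ} (hD : 0 ≤ D) (hε : 0 < ε)
    (hdiam : intrinsicDiam (liftedDist π) K ≤ ENNReal.ofReal D)
    (hgap : ENNReal.ofReal ε ≤ piGap π K e.source) {p z : W} (hp : p ∈ K) (hp0 : e p = 0)
    (hz : z ∈ K) : hypDist (e z) ≤ 2 * D / ε := by
  have key : ∀ c, 2 / ε < c → hypDist (e z) ≤ c * D := by
    intro c hc
    have h1 := dist_le_mul_of_intrinsicDiam_le (h := fun q => hypDist (e q))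
      (lt_trans (by positivity) hc) hD hdiam (fun q hq => eventually_abs_hypDist_sub_le he ht
        hπ hπ' hε (hgap.trans (iInf₂_le q hq)) hc) hp hz
    simp only [hp0, hypDist_zero, sub_zero] at h1
    exact (le_abs_self _).trans h1
  -- Letting `c` decrease to `2 / ε` recovers the sharp constant.
  have hlim : Tendsto (fun c => c * D) (𝓝[>] (2 / ε)) (𝓝 (2 / ε * D)) :=
    ((continuous_mul_const D).tendsto _).mono_left nhdsWithin_le_nhds
  refine (ge_of_tendsto hlim (eventually_mem_nhdsWithin.mono key)).trans_eq ?_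
  ring

include he in
/-- The multiplicity of a zero can be computed in any holomorphic coordinate. -/
theorem zeroMult_eq_analyticOrderAt [IsManifold 𝓘(ℂ) 1 W] (f : W → ℂ) {z : W}
    (hz : z ∈ e.source) : zeroMult f z = analyticOrderAt (f ∘ e.symm) (e z) := by
  set c := chartAt ℂ z
  have hzc : z ∈ c.source := mem_chart_source ℂ z
  have hT : (c.symm.trans e).MDifferentiable 𝓘(ℂ) 𝓘(ℂ) := (mdifferentiable_chart z).symm.trans he
  have hmem : c z ∈ (c.symm.trans e).source := by
    simp [hzc, hz]
  have hval : (c.symm.trans e) (c z) = e z := by simp [hzc]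
  have hnhds := (c.symm.trans e).open_source.mem_nhds hmem
  have han : AnalyticAt ℂ (c.symm.trans e) (c z) := hT.1.differentiableOn.analyticAt hnhds
  have hderiv : deriv (c.symm.trans e) (c z) ≠ 0 := by
    intro h0
    have h1 := hT.mfderiv_injective hmem
    rw [mfderiv_eq_fderiv] at h1
    have h2 : fderiv ℂ (c.symm.trans e) (c z) 1 = fderiv ℂ (c.symm.trans e) (c z) 0 := by
      rw [map_zero]
      exact h0
    exact one_ne_zero (α := ℂ) (h1 h2)
  rw [← hval, ← analyticOrderAt_comp_of_deriv_ne_zero han hderiv]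
  apply analyticOrderAt_congr
  filter_upwards [hnhds] with w hw
  simp only [OpenPartialHomeomorph.trans_source, OpenPartialHomeomorph.symm_source, mem_inter_iff,
    mem_preimage] at hw
  simp [e.left_inv hw.2, c]

end disk

/-! ### Counting the zeros -/

/-- Every point of a nontrivial connected set is an accumulation point, so the identity theorem
applies. This makes `max_K |f|` positive. -/
theorem exists_mem_ne_zero [IsManifold 𝓘(ℂ) 1 W] [T1Space W] {U K : Set W}
    (hU : ConformalToDisk U) (hKU : K ⊆ U) (hKp : IsPreconnected K) (hKn : K.Nontrivial)
    {f : W → ℂ} (hf : MDifferentiableOn 𝓘(ℂ) 𝓘(ℂ) f U) (hf0 : ∃ z ∈ U, f z ≠ 0) :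
    ∃ z ∈ K, f z ≠ 0 := by
  by_contra! hK
  obtain ⟨z₀, hz₀⟩ := hKn.nonempty
  obtain ⟨e, he, rfl, ht, -⟩ := hU.exists_apply_eq_zero (hKU hz₀)
  have hF := differentiableOn_comp_symm he hf
  have hinj : InjOn e K := e.injOn.mono hKU
  have hacc : AccPt (e z₀) (𝓟 (e '' K)) :=
    (hKp.image e (e.continuousOn.mono hKU)).preperfect_of_nontrivial (hKn.image_of_injOn hinj) _
      (mem_image_of_mem e hz₀)
  have hfreq : ∃ᶠ w in 𝓝[≠] e z₀, (f ∘ e.symm) w = 0 := by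
    refine (accPt_iff_frequently_nhdsNE.mp hacc).mono ?_
    rintro _ ⟨z, hz, rfl⟩
    rw [Function.comp_apply, e.left_inv (hKU hz), hK z hz]
  have hzero := (hF.analyticOnNhd e.open_target).eqOn_zero_of_preconnected_of_frequently_eq_zero
    (by rw [ht]; exact (convex_ball 0 1).isPreconnected) (e.map_source (hKU hz₀)) hfreq
  obtain ⟨z, hz, hfz⟩ := hf0
  have := hzero (e.map_source hz)
  rw [Function.comp_apply, e.left_inv hz] at this
  exact hfz this

/-- The growth-and-zeros estimate for finite sets of zeros with prescribed multiplicities. -/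
theorem sum_le_exp_mul_bernsteinIndex [IsManifold 𝓘(ℂ) 1 W] [T1Space W]
    {π : W → ℂ} (hπ : MDifferentiable 𝓘(ℂ) 𝓘(ℂ) π)
    (hπ' : ∀ p : W, mfderiv 𝓘(ℂ) 𝓘(ℂ) π p ≠ 0)
    {U K : Set W} (hU : ConformalToDisk U) (hKU : K ⊆ U) (hKc : IsCompact K)
    (hKp : IsPreconnected K) (hKn : K.Nontrivial) {D ε : ℝ} (hD0 : 0 ≤ D) (hε0 : 0 < ε)
    (hdiam : intrinsicDiam (liftedDist π) K ≤ ENNReal.ofReal D)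
    (hgap : ENNReal.ofReal ε ≤ piGap π K U)
    {f : W → ℂ} (hf : MDifferentiableOn 𝓘(ℂ) 𝓘(ℂ) f U)
    (hfb : ∃ C : ℝ, ∀ z ∈ U, ‖f z‖ ≤ C) (hf0 : ∃ z ∈ U, f z ≠ 0)
    (S : Finset W) (hS : ∀ z ∈ S, z ∈ K) (n : W → ℕ) (hn : ∀ z ∈ S, (n z : ℕ∞) ≤ zeroMult f z) :
    ((∑ z ∈ S, n z : ℕ) : ℝ) ≤ Real.exp (2 * D / ε) * bernsteinIndex K U f := by
  obtain ⟨z₀, hz₀, hmax⟩ := hKc.exists_isMaxOn hKn.nonempty (hf.continuousOn.mono hKU).norm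
  have hm : sSup ((fun z => ‖f z‖) '' K) = ‖f z₀‖ :=
    IsGreatest.csSup_eq ⟨mem_image_of_mem _ hz₀, by rintro _ ⟨z, hz, rfl⟩; exact hmax hz⟩
  have hm0 : 0 < ‖f z₀‖ := by
    obtain ⟨z, hz, hfz⟩ := exists_mem_ne_zero hU hKU hKp hKn hf hf0
    exact (norm_pos_iff.mpr hfz).trans_le (hmax hz)
  obtain ⟨C, hC⟩ := hfb
  have hM : ∀ z ∈ U, ‖f z‖ ≤ sSup ((fun z => ‖f z‖) '' U) := fun z hz =>
    le_csSup ⟨C, by rintro _ ⟨w, hw, rfl⟩; exact hC w hw⟩ (mem_image_of_mem _ hz)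
  rw [bernsteinIndex, hm]
  set M := sSup ((fun z => ‖f z‖) '' U)
  obtain ⟨e, he, rfl, ht, he0⟩ := hU.exists_apply_eq_zero (hKU hz₀)
  have hinj : InjOn e S := e.injOn.mono fun z hz => hKU (hS z hz)
  have hlt : ∀ z ∈ S, ‖e z‖ < 1 := fun z hz => by
    simpa [ht] using e.map_source (hKU (hS z hz))
  have hF : DifferentiableOn ℂ (f ∘ e.symm) (ball 0 1) := ht ▸ differentiableOn_comp_symm he hf
  have hJ := norm_apply_zero_le_mul_prod hF
    (fun w hw => hM _ (e.map_target (ht ▸ hw))) (S.image e) (n ∘ e.symm)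
    (by simpa using hlt) (by
      simp only [Finset.forall_mem_image, Function.comp_apply]
      intro z hz
      rw [e.left_inv (hKU (hS z hz)), ← zeroMult_eq_analyticOrderAt he f (hKU (hS z hz))]
      exact hn z hz)
  rw [← he0, Function.comp_apply, e.left_inv (hKU hz₀), Finset.prod_image hinj] at hJ
  set ρ := 2 * D / ε
  have hprod : ∏ z ∈ S, ‖e z‖ ^ (n ∘ e.symm) (e z) ≤
      Real.exp (-Real.exp (-ρ)) ^ (∑ z ∈ S, n z) := by
    rw [← Finset.prod_pow_eq_pow_sum]
    refine Finset.prod_le_prod (fun z _ => by positivity) fun z hz => ?_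
    rw [Function.comp_apply, e.left_inv (hKU (hS z hz))]
    exact pow_le_pow_left₀ (norm_nonneg _) (norm_le_exp_of_hypDist_le (hlt z hz)
      (hypDist_le_of_intrinsicDiam_le he ht hπ hπ' hD0 hε0 hdiam hgap hz₀ he0 (hS z hz))) _
  have hM0 : 0 < M := hm0.trans_le (hM _ (hKU hz₀))
  generalize ∑ z ∈ S, n z = N at hprod ⊢
  have h1 : ‖f z₀‖ ≤ Real.exp (-(N * Real.exp (-ρ))) * M := by
    refine hJ.trans (mul_le_mul_of_nonneg_right (hprod.trans_eq ?_) hM0.le)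
    rw [← Real.exp_nat_mul, mul_neg]
  have h2 : N * Real.exp (-ρ) ≤ Real.log (M / ‖f z₀‖) := by
    rw [Real.le_log_iff_exp_le (by positivity), le_div_iff₀ hm0]
    rw [Real.exp_neg, inv_mul_eq_div, le_div_iff₀ (Real.exp_pos _)] at h1
    linarith
  calc (N : ℝ) = Real.exp ρ * (N * Real.exp (-ρ)) := by
        rw [mul_left_comm, ← Real.exp_add, add_neg_cancel, Real.exp_zero, mul_one]
    _ ≤ _ := mul_le_mul_of_nonneg_left h2 (Real.exp_pos ρ).le

theorem one_le_zeroMult [IsManifold 𝓘(ℂ) 1 W] {U : Set W} (hU : ConformalToDisk U) {f : W → ℂ}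
    (hf : MDifferentiableOn 𝓘(ℂ) 𝓘(ℂ) f U) {z : W} (hz : z ∈ U) (hfz : f z = 0) :
    1 ≤ zeroMult f z := by
  obtain ⟨e, he, rfl, -, -⟩ := hU.exists_apply_eq_zero hz
  rw [Order.one_le_iff_ne_zero, zeroMult_eq_analyticOrderAt he f hz]
  exact analyticOrderAt_ne_zero.mpr ⟨(differentiableOn_comp_symm he hf).analyticAt
    (e.open_target.mem_nhds (e.map_source hz)), by rw [Function.comp_apply, e.left_inv hz, hfz]⟩

theorem tsum_le_of_forall_natCast_le {ι : Type*} {a : ι → ℕ∞} {B : ℝ}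
    (h : ∀ (S : Finset ι) (n : ι → ℕ), (∀ i ∈ S, (n i : ℕ∞) ≤ a i) →
      ((∑ i ∈ S, n i : ℕ) : ℝ) ≤ B) :
    ∑' i, (a i : ℝ≥0∞) ≤ ENNReal.ofReal B := by
  have htop : ∀ i, a i ≠ ⊤ := by
    intro i hi
    obtain ⟨N, hN⟩ := exists_nat_gt B
    have := h {i} (fun _ => N) (by simp [hi])
    simp only [Finset.sum_singleton] at this
    linarith
  rw [ENNReal.tsum_eq_iSup_sum]
  refine iSup_le fun S => ?_
  have h1 := h S (fun i => (a i).toNat) fun i _ => (ENat.natCast_toNat (htop i)).le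
  have h2 : ∑ i ∈ S, (a i : ℝ≥0∞) = ((∑ i ∈ S, (a i).toNat : ℕ) : ℝ≥0∞) := by
    rw [Nat.cast_sum]
    refine Finset.sum_congr rfl fun i _ => ?_
    conv_lhs => rw [← ENat.natCast_toNat (htop i)]
    rfl
  rw [h2, ← ENNReal.ofReal_natCast]
  exact ENNReal.ofReal_le_ofReal h1

end GrowthZeros

theorem mainTheorem3 {W : Type*} [TopologicalSpace W] [T2Space W] [ChartedSpace ℂ W]
    [IsManifold 𝓘(ℂ) 1 W]
    (π : W → ℂ) (hπ : MDifferentiable 𝓘(ℂ) 𝓘(ℂ) π)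
    (hπ' : ∀ p : W, mfderiv 𝓘(ℂ) 𝓘(ℂ) π p ≠ 0)
    (U : Set W) (hU : GrowthZeros.ConformalToDisk U)
    (K : Set W) (hKU : K ⊆ U) (hKc : IsCompact K) (hKp : IsPathConnected K)
    (hKn : K.Nontrivial)
    (D ε : ℝ) (hD0 : 0 ≤ D) (hε0 : 0 < ε)
    (hdiam : GrowthZeros.intrinsicDiam (GrowthZeros.liftedDist π) K ≤ ENNReal.ofReal D)
    (hgap : ENNReal.ofReal ε ≤ GrowthZeros.piGap π K U)
    (f : W → ℂ) (hf : MDifferentiableOn 𝓘(ℂ) 𝓘(ℂ) f U)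
    (hfb : ∃ C : ℝ, ∀ z ∈ U, ‖f z‖ ≤ C) (hf0 : ∃ z ∈ U, f z ≠ 0) :
    (GrowthZeros.zerosIn K f).Finite ∧
    ((GrowthZeros.zerosIn K f).ncard : ℝ) ≤
      Real.exp (2 * D / ε) * GrowthZeros.bernsteinIndex K U f ∧
    (∑' z : GrowthZeros.zerosIn K f, (GrowthZeros.zeroMult f z : ℝ≥0∞)) ≤
      ENNReal.ofReal (Real.exp (2 * D / ε) * GrowthZeros.bernsteinIndex K U f) := by
  have key := GrowthZeros.sum_le_exp_mul_bernsteinIndex hπ hπ' hU hKU hKc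
    hKp.isConnected.isPreconnected hKn hD0 hε0 hdiam hgap hf hfb hf0
  set B := Real.exp (2 * D / ε) * GrowthZeros.bernsteinIndex K U f
  have hcard : ∀ S : Finset W, ↑S ⊆ GrowthZeros.zerosIn K f → (S.card : ℝ) ≤ B := by
    intro S hS
    simpa using key S (fun z hz => (hS hz).1) (fun _ => 1) fun z hz =>
      GrowthZeros.one_le_zeroMult hU hf (hKU (hS hz).1) (hS hz).2
  -- Finiteness follows because the cardinalities of finite subsets are uniformly bounded.
  have hfin : (GrowthZeros.zerosIn K f).Finite := by
    by_contra hinf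
    obtain ⟨N, hN⟩ := exists_nat_gt B
    obtain ⟨S, hS, hSN⟩ := Set.Infinite.exists_subset_card_eq hinf N
    have := hcard S hS
    rw [hSN] at this
    linarith
  refine ⟨hfin, ?_, ?_⟩
  · rw [Set.ncard_eq_toFinset_card _ hfin]
    exact hcard _ (by simp)
  · refine GrowthZeros.tsum_le_of_forall_natCast_le fun S n hn => ?_
    classical
    have h1 := key (S.map (Function.Embedding.subtype _))
      (fun z hz => by obtain ⟨w, -, rfl⟩ := Finset.mem_map.mp hz; exact w.2.1)
      -- The multiplicities live on the subtype of zeros; the value `0` elsewhere is never used in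
      -- the sum.
      (fun z => if hz : z ∈ GrowthZeros.zerosIn K f then n ⟨z, hz⟩ else 0)
      (fun z hz => by obtain ⟨w, hw, rfl⟩ := Finset.mem_map.mp hz; simpa using hn w hw)
    simpa [Finset.sum_map] using h1
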